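/- Let $R$ be a commutative artinian ring and let $\Lambda$ be an artin $R$-algebra, i.e. an $R$-algebra that is finitely generated as an $R$-module. Let $\mathcal P$ be the class of all finitely generated right $\Lambda$-modules of finite projective dimension. A right $\mathcal P$-approximation of a finitely generated right $\Lambda$-module $M$ is a morphism $f\colon A\to M$ with $A\in\mathcal P$ such that every morphism $X\to M$ with $X\in\mathcal P$ factors through $f$; it is minimal if every endomorphism $g$ of $A$ with $fg=f$ is an isomorphism. A module $X\in\mathcal P$ is Ext-injective in $\mathcal P$ if $\operatorname{Ext}^1_\Lambda(Y,X)=0$ for all $Y\in\mathcal P$. Suppose that $\mathcal P$ is contravariantly finite, i.e. that every finitely generated right $\Lambda$-module has a right $\mathcal P$-approximation. Then every finitely generated indecomposable injective right $\Lambda$-module $I$ has a minimal right $\mathcal P$-approximation $f_I\colon A_I\to I$, and it is unique up to isomorphism over $I$. Moreover, an indecomposable right $\Lambda$-module $X$ is isomorphic to a direct summand of $A_I$ for some finitely generated indecomposable injective right $\Lambda$-module $I$ if and only if $X$ is an Ext-injective module in $\mathcal P$. -/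

import Mathlib

open CategoryTheory CategoryTheory.Limits CategoryTheory.Abelian

universe w u

namespace ApproximationTheory

section Category

variable {C : Type w} [Category.{u} C]

/-- A right `𝒳`-approximation of `M`: a morphism `f : A ⟶ M` with `A` in `𝒳` through which
every morphism from an object of `𝒳` to `M` factors. -/
def IsRightApproximation (𝒳 : ObjectProperty C) {A M : C} (f : A ⟶ M) : Prop :=
  𝒳 A ∧ ∀ X : C, 𝒳 X → ∀ g : X ⟶ M, ∃ h : X ⟶ A, h ≫ f = g

/-- A morphism `f : A ⟶ M` is right minimal if every endomorphism `g` of `A` with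
`f ∘ g = f` is an isomorphism. -/
def IsRightMinimal {A M : C} (f : A ⟶ M) : Prop :=
  ∀ g : A ⟶ A, g ≫ f = f → IsIso g

/-- A minimal right `𝒳`-approximation. -/
def IsMinimalRightApproximation (𝒳 : ObjectProperty C) {A M : C} (f : A ⟶ M) : Prop :=
  IsRightApproximation 𝒳 f ∧ IsRightMinimal f

/-- `X` is (isomorphic to) a direct summand of `A`. -/
def IsDirectSummand [HasZeroMorphisms C] [HasBinaryBiproducts C] (X A : C) : Prop :=
  ∃ Y : C, Nonempty (A ≅ X ⊞ Y)

end Category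

section Modules

variable (Λ : Type u) [Ring Λ]

/-- The category of all right `Λ`-modules. -/
abbrev RightMod : Type (u + 1) := ModuleCat.{u} Λᵐᵒᵖ

/-- The class of finitely generated right `Λ`-modules. -/
def fgRightMod : ObjectProperty (RightMod Λ) :=
  fun M => Module.Finite Λᵐᵒᵖ M

/-- The class of finitely generated right `Λ`-modules of finite projective dimension. -/
def finiteProjDim : ObjectProperty (RightMod Λ) :=
  fun M => fgRightMod Λ M ∧ ∃ n : ℕ, HasProjectiveDimensionLE M n

variable {Λ}

/-- A class `𝒳` of modules is contravariantly finite in the category of finitely generated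
right `Λ`-modules if every finitely generated module has a right `𝒳`-approximation. -/
def IsContravariantlyFinite (𝒳 : ObjectProperty (RightMod Λ)) : Prop :=
  ∀ M : RightMod Λ, fgRightMod Λ M →
    ∃ (A : RightMod Λ) (f : A ⟶ M), IsRightApproximation 𝒳 f

/-- `X` is Ext-injective in `𝒳`: it lies in `𝒳` and `Ext¹(Y, X) = 0` for every `Y` in `𝒳`. -/
def IsExtInjective (𝒳 : ObjectProperty (RightMod Λ)) (X : RightMod Λ) : Prop :=
  𝒳 X ∧ ∀ Y : RightMod Λ, 𝒳 Y → Subsingleton (Ext.{u} Y X 1)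

/-- `I` is a finitely generated indecomposable injective right `Λ`-module. -/
def IsIndecomposableInjective (I : RightMod Λ) : Prop :=
  fgRightMod Λ I ∧ Injective I ∧ Indecomposable I

end Modules

end ApproximationTheory

/-! Write 𝒫 for the class. Minimal approximations come from splitting off images of powers of
endomorphisms, by Fitting's lemma. If `f : A ⟶ I` is one with `I` injective, represent a class in
`Ext¹(Y, A)` by a map `K ⟶ A`, with `K` a syzygy of `Y`, and push out along `K ⟶ P`. The pushout is
again in 𝒫 and, as `I` is injective, `f` extends to it. Factoring this extension through `f` and
using minimality splits `A` off, so the class vanishes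
(`isExtInjective_of_isMinimalRightApproximation`). Summands inherit this. Conversely, embed an
Ext-injective `X` in a finitely generated injective `J` (`exists_mono_injective`). The embedding
factors through an approximation `A ⟶ J` by a monomorphism `X ⟶ A`, whose cokernel is in 𝒫, so it
splits. Decomposing `J` into indecomposables then locates `X`
(`exists_isRightApproximation_of_injective`). -/

namespace ApproximationTheory

/-! ### Essential extensions and finiteness of injective hulls -/

section EssentialExtensions

/-- If `M` is a finitely generated essential submodule of `E` over an Artin algebra, then the
homomorphisms from a module of finite length to `E` form a noetherian module over the base. -/
lemma isNoetherian_linearMap_of_essential {R : Type w} {S E : Type u} [CommRing R]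
    [IsArtinianRing R] [Ring S] [Algebra R S] [Module.Finite R S] [AddCommGroup E] [Module S E]
    [Module R E] [IsScalarTower R S E] (M : Submodule S E) (hM : M.FG)
    (hess : ∀ L : Submodule S E, Disjoint L M → L = ⊥)
    {T : Type u} [AddCommGroup T] [Module S T] (hT : IsFiniteLength S T) :
    haveI := IsScalarTower.to_smulCommClass (R := R) (A := S) (M := E)
    IsNoetherian R (T →ₗ[S] E) := by
  have := IsScalarTower.to_smulCommClass (R := R) (A := S) (M := E)
  have := IsScalarTower.to_smulCommClass' (R := R) (A := S) (M := E)
  induction hT with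
  | of_subsingleton => infer_instance
  | @of_simple_quotient T _ _ N _ _ ih =>
    have : Module.Finite S M := Module.Finite.iff_fg.mpr hM
    have : Module.Finite R M := Module.Finite.trans S M
    have hquot : IsNoetherian R ((T ⧸ N) →ₗ[S] E) := by
      have := IsSimpleModule.nontrivial S (T ⧸ N)
      obtain ⟨t, ht⟩ := exists_ne (0 : T ⧸ N)
      -- A nonzero image of a simple module meets `M`, hence lies in `M`. So evaluation at `t`
      -- embeds the homomorphisms in `M`, which is finite over `R`.
      have hmem (f : (T ⧸ N) →ₗ[S] E) : f t ∈ M := by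
        rcases LinearMap.injective_or_eq_zero f with hf | rfl
        · rcases eq_bot_or_eq_top (M.comap f) with h | h
          · have hr : LinearMap.range f = ⊥ := by
              refine hess _ (Submodule.disjoint_def.mpr ?_)
              rintro _ ⟨y, rfl⟩ hy
              have : y ∈ M.comap f := hy
              rw [h, Submodule.mem_bot] at this
              rw [this, map_zero]
            rw [LinearMap.range_eq_bot.mp hr]
            exact M.zero_mem
          · have : t ∈ M.comap f := h ▸ Submodule.mem_top
            exact this
        · exact M.zero_mem
      let ev : ((T ⧸ N) →ₗ[S] E) →ₗ[R] M :=
        { toFun := fun f => ⟨f t, hmem f⟩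
          map_add' := fun _ _ => rfl
          map_smul' := fun _ _ => rfl }
      refine isNoetherian_of_injective ev fun f g hfg => ?_
      have h0 : f t = g t := congrArg Subtype.val hfg
      rcases LinearMap.injective_or_eq_zero (f - g) with h | h
      · exact absurd (h (by simp [h0] : (f - g) t = (f - g) 0)) ht
      · exact sub_eq_zero.mp h
    let pre : ((T ⧸ N) →ₗ[S] E) →ₗ[R] (T →ₗ[S] E) :=
      { toFun := fun f => f ∘ₗ N.mkQ
        map_add' := fun _ _ => rfl
        map_smul' := fun _ _ => rfl }
    let res : (T →ₗ[S] E) →ₗ[R] (N →ₗ[S] E) :=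
      { toFun := fun f => f ∘ₗ N.subtype
        map_add' := fun _ _ => rfl
        map_smul' := fun _ _ => rfl }
    refine isNoetherian_of_range_eq_ker pre res (le_antisymm ?_ ?_)
    · rintro _ ⟨f, rfl⟩
      ext x
      have : N.mkQ (x : T) = 0 := (Submodule.Quotient.mk_eq_zero N).mpr x.2
      change f (N.mkQ (x : T)) = 0
      rw [this, map_zero]
    · intro f hf
      refine ⟨N.liftQ f fun x hx => ?_, N.liftQ_mkQ f _⟩
      exact LinearMap.congr_fun hf ⟨x, hx⟩

/-- An essential extension of a finitely generated module over an Artin algebra is finitely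
generated. -/
lemma finite_of_essential (R : Type w) {S E : Type u} [CommRing R]
    [IsArtinianRing R] [Ring S] [Algebra R S] [Module.Finite R S] [AddCommGroup E] [Module S E]
    (M : Submodule S E) (hM : M.FG)
    (hess : ∀ L : Submodule S E, Disjoint L M → L = ⊥) : Module.Finite S E := by
  let : Module R E := Module.compHom E (algebraMap R S)
  have : IsScalarTower R S E := ⟨fun r s e => by
    change (r • s) • e = algebraMap R S r • (s • e)
    rw [Algebra.smul_def, mul_smul]⟩
  have := IsScalarTower.to_smulCommClass (R := R) (A := S) (M := E)
  have := IsScalarTower.to_smulCommClass' (R := R) (A := S) (M := E)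
  have : IsNoetherianRing S := IsNoetherianRing.of_finite R S
  have : IsArtinianRing S := IsArtinianRing.of_finite R S
  have : IsNoetherian R (S →ₗ[S] E) := isNoetherian_linearMap_of_essential M hM hess
    (isFiniteLength_iff_isNoetherian_isArtinian.mpr ⟨inferInstance, inferInstance⟩)
  have : IsNoetherian R E :=
    isNoetherian_of_linearEquiv (LinearMap.ringLmapEquivSelf S R E)
  exact Module.Finite.of_restrictScalars_finite R S E

/-- Every submodule of an injective module is contained in a direct summand in which it is
essential. -/
lemma exists_essential_retract {S Q : Type u} [Ring S] [AddCommGroup Q] [Module S Q]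
    [Module.Injective S Q] (M : Submodule S Q) :
    ∃ E : Submodule S Q, M ≤ E ∧ (∀ L ≤ E, Disjoint L M → L = ⊥) ∧
      ∃ p : Q →ₗ[S] E, p ∘ₗ E.subtype = LinearMap.id := by
  obtain ⟨E, hME, hE⟩ := zorn_le_nonempty₀
    {N : Submodule S Q | M ≤ N ∧ ∀ L ≤ N, Disjoint L M → L = ⊥} (fun c hc hchain N hN => by
      refine ⟨sSup c, ⟨(hc hN).1.trans (le_sSup hN), fun L hL hLM => ?_⟩, fun _ => le_sSup⟩
      refine (Submodule.eq_bot_iff L).mpr fun x hx => ?_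
      obtain ⟨N', hN', hxN'⟩ :=
        (Submodule.mem_sSup_of_directed ⟨N, hN⟩ hchain.directedOn).mp (hL hx)
      have hspan : Submodule.span S {x} ≤ L := (Submodule.span_singleton_le_iff_mem x L).mpr hx
      exact Submodule.span_singleton_eq_bot.mp ((hc hN').2 _
        ((Submodule.span_singleton_le_iff_mem x N').mpr hxN') (hLM.mono_left hspan)))
    M ⟨le_rfl, fun L hL hLM => hLM.eq_bot_of_le hL⟩
  -- `E` is a maximal essential extension of `M` inside `Q`, and `C` is maximal among submodules
  -- disjoint from `E`. Extending the inclusion of `E` along `E → Q ⧸ C` gives `φ`; its image is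
  -- essential over `M`, so maximality of `E` makes `φ` a projection onto `E`.
  obtain ⟨C, -, hC⟩ := zorn_le_nonempty₀ {C : Submodule S Q | Disjoint C E}
    (fun c hc hchain _ _ => ⟨sSup c, hchain.directedOn.disjoint_sSup_left.mpr fun _ h => hc h,
      fun _ => le_sSup⟩) ⊥ disjoint_bot_left
  have hinj : Function.Injective (C.mkQ ∘ₗ E.subtype) := by
    rw [← LinearMap.ker_eq_bot, LinearMap.ker_comp, Submodule.ker_mkQ,
      ← Submodule.disjoint_iff_comap_eq_bot]
    exact (show Disjoint C E from hC.prop).symm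
  obtain ⟨φ, hφ⟩ := Module.Injective.out (C.mkQ ∘ₗ E.subtype) hinj E.subtype
  have hφ' (x : Q) (hx : x ∈ E) : φ (C.mkQ x) = x := hφ ⟨x, hx⟩
  have hrange : LinearMap.range (φ ∘ₗ C.mkQ) ≤ E := by
    refine hE.le_of_ge ⟨fun x hx => ⟨x, hφ' x (hME hx)⟩, fun L hL hLM => ?_⟩
      fun x hx => ⟨x, hφ' x hx⟩
    have hLE : L ⊓ E = ⊥ := hE.prop.2 _ inf_le_right (hLM.mono_left inf_le_left)
    have hdisj : Disjoint (L.comap (φ ∘ₗ C.mkQ)) E := by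
      refine Submodule.disjoint_def.mpr fun x hx hxE => ?_
      have hxL : φ (C.mkQ x) ∈ L := hx
      rw [hφ' x hxE] at hxL
      exact (Submodule.eq_bot_iff _).mp hLE x ⟨hxL, hxE⟩
    have hle : L.comap (φ ∘ₗ C.mkQ) ≤ C := hC.le_of_ge hdisj fun x hx => by
      have : C.mkQ x = 0 := (Submodule.Quotient.mk_eq_zero C).mpr hx
      rw [Submodule.mem_comap, LinearMap.comp_apply, this, map_zero]
      exact L.zero_mem
    refine (Submodule.eq_bot_iff L).mpr fun y hy => ?_
    obtain ⟨q, rfl⟩ := hL hy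
    have : C.mkQ q = 0 := (Submodule.Quotient.mk_eq_zero C).mpr (hle hy)
    rw [LinearMap.comp_apply, this, map_zero]
  refine ⟨E, hME, hE.prop.2, (φ ∘ₗ C.mkQ).codRestrict E fun x => hrange ⟨x, rfl⟩, ?_⟩
  ext x
  exact hφ' x x.2

end EssentialExtensions

/-! ### Formal properties of approximations and retracts -/

section Category

variable {C : Type w} [Category.{u} C]

lemma IsMinimalRightApproximation.exists_iso {𝒳 : ObjectProperty C} {A A' M : C} {f : A ⟶ M}
    {f' : A' ⟶ M} (hf : IsMinimalRightApproximation 𝒳 f)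
    (hf' : IsMinimalRightApproximation 𝒳 f') : ∃ e : A ≅ A', e.hom ≫ f' = f := by
  obtain ⟨h, hh⟩ := hf'.1.2 A hf.1.1 f
  obtain ⟨k, hk⟩ := hf.1.2 A' hf'.1.1 f'
  have h1 : IsIso (h ≫ k) := hf.2 _ (by rw [Category.assoc, hk, hh])
  have h2 : IsIso (k ≫ h) := hf'.2 _ (by rw [Category.assoc, hh, hk])
  have : IsSplitMono h := IsSplitMono.mk' ⟨k ≫ inv (h ≫ k), by
    rw [← Category.assoc, IsIso.hom_inv_id]⟩
  have : Epi h := epi_of_epi k h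
  have : IsIso h := isIso_of_epi_of_isSplitMono h
  exact ⟨asIso h, hh⟩

lemma Retract.isDirectSummand [Abelian C] {X A : C} (h : Retract X A) : IsDirectSummand X A := by
  have : IsSplitMono h.i := IsSplitMono.mk' ⟨h.r, h.retract⟩
  exact ⟨_, ⟨biprod.uniqueUpToIso _ _
    (isBilimitBinaryBiconeOfIsSplitMonoOfCokernel (colimit.isColimit (parallelPair h.i 0)))⟩⟩

lemma IsDirectSummand.nonempty_retract [Preadditive C] [HasBinaryBiproducts C] {X A : C}
    (h : IsDirectSummand X A) : Nonempty (Retract X A) := by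
  obtain ⟨Y, ⟨e⟩⟩ := h
  exact ⟨⟨biprod.inl ≫ e.inv, e.hom ≫ biprod.fst, by simp⟩⟩

lemma IsRightApproximation.biprod_map [Preadditive C] [HasBinaryBiproducts C]
    {𝒳 : ObjectProperty C} {A A' M M' : C} {f : A ⟶ M} {f' : A' ⟶ M'}
    (hf : IsRightApproximation 𝒳 f) (hf' : IsRightApproximation 𝒳 f') (h : 𝒳 (A ⊞ A')) :
    IsRightApproximation 𝒳 (biprod.map f f') := by
  refine ⟨h, fun X hX g => ?_⟩
  obtain ⟨a, ha⟩ := hf.2 X hX (g ≫ biprod.fst)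
  obtain ⟨b, hb⟩ := hf'.2 X hX (g ≫ biprod.snd)
  exact ⟨biprod.lift a b, by ext <;> simp [ha, hb]⟩

lemma IsRightApproximation.comp_iso {𝒳 : ObjectProperty C} {A M N : C} {f : A ⟶ M}
    (hf : IsRightApproximation 𝒳 f) (e : M ≅ N) : IsRightApproximation 𝒳 (f ≫ e.hom) := by
  refine ⟨hf.1, fun X hX g => ?_⟩
  obtain ⟨a, ha⟩ := hf.2 X hX (g ≫ e.inv)
  exact ⟨a, by rw [← Category.assoc, ha, Category.assoc, e.inv_hom_id, Category.comp_id]⟩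

end Category

/-! ### Fitting's lemma and its consequences -/

section FiniteLength

variable {S : Type u} [Ring S]

/-- Fitting decomposition: an endomorphism of a module of finite length which is not an
isomorphism has a power whose image is a proper direct summand. -/
lemma exists_isCompl_of_not_isIso {A : ModuleCat.{u} S} [IsNoetherian S A] [IsArtinian S A]
    (g : A ⟶ A) (hg : ¬ IsIso g) :
    ∃ n : ℕ, IsCompl (LinearMap.ker (g.hom ^ n)) (LinearMap.range (g.hom ^ n)) ∧
      LinearMap.range (g.hom ^ n) ≠ ⊤ := by
  obtain ⟨n, hn⟩ := Filter.eventually_atTop.mp g.hom.eventually_isCompl_ker_pow_range_pow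
  -- The exponent must be nonzero for a unit power to force `g` to be a unit.
  refine ⟨n + 1, hn _ n.le_succ, fun htop => hg ?_⟩
  have hker := (hn _ n.le_succ).disjoint.eq_bot
  rw [htop, inf_top_eq] at hker
  have hunit : IsUnit (g.hom ^ (n + 1)) :=
    (Module.End.isUnit_iff _).mpr ⟨LinearMap.ker_eq_bot.mp hker, LinearMap.range_eq_top.mp htop⟩
  exact (ConcreteCategory.isIso_iff_bijective g).mpr
    ((Module.End.isUnit_iff _).mp ((isUnit_pow_iff n.succ_ne_zero).mp hunit))

/-- A module is the biproduct of two complementary submodules. -/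
noncomputable def isoBiprodOfIsCompl {A : ModuleCat.{u} S} {N N' : Submodule S A}
    (h : IsCompl N N') : A ≅ ModuleCat.of S N ⊞ ModuleCat.of S N' :=
  (Submodule.prodEquivOfIsCompl N N' h).symm.toModuleIso ≪≫
    (ModuleCat.biprodIsoProd (ModuleCat.of S N) (ModuleCat.of S N')).symm

lemma Indecomposable.isIso_or_pow_eq_zero {X : ModuleCat.{u} S} [IsNoetherian S X]
    [IsArtinian S X] (hX : Indecomposable X) (g : X ⟶ X) :
    IsIso g ∨ ∃ n : ℕ, g.hom ^ n = 0 := by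
  by_contra! hcon
  obtain ⟨n, hcompl, hne⟩ := exists_isCompl_of_not_isIso g hcon.1
  rcases hX.2 _ _ (isoBiprodOfIsCompl hcompl) with h | h
  · have := ModuleCat.subsingleton_of_isZero h
    rw [Submodule.eq_bot_of_subsingleton (p := LinearMap.ker (g.hom ^ n))] at hcompl
    exact hne (eq_top_of_bot_isCompl hcompl)
  · have := ModuleCat.subsingleton_of_isZero h
    exact hcon.2 n (LinearMap.range_eq_bot.mp
      (Submodule.eq_bot_of_subsingleton (p := LinearMap.range (g.hom ^ n))))

/-- An indecomposable module of finite length which is a direct summand of a direct sum is a direct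
summand of one of the terms. -/
lemma Indecomposable.retract_of_retract_biprod {X A B : ModuleCat.{u} S} [IsNoetherian S X]
    [IsArtinian S X] (hX : Indecomposable X) (h : Retract X (A ⊞ B)) :
    Nonempty (Retract X A) ∨ Nonempty (Retract X B) := by
  have hsum : (h.i ≫ biprod.fst) ≫ (biprod.inl ≫ h.r) +
      (h.i ≫ biprod.snd) ≫ (biprod.inr ≫ h.r) = 𝟙 X := by
    have := h.retract
    rw [← Category.id_comp h.r, ← biprod.total, Preadditive.add_comp, Preadditive.comp_add] at this
    simpa only [Category.assoc] using this
  have key {Y : ModuleCat.{u} S} (a : X ⟶ Y) (b : Y ⟶ X) (hab : IsIso (a ≫ b)) :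
      Nonempty (Retract X Y) :=
    ⟨⟨a, b ≫ inv (a ≫ b), by rw [← Category.assoc, IsIso.hom_inv_id]⟩⟩
  rcases Indecomposable.isIso_or_pow_eq_zero hX
    ((h.i ≫ biprod.fst) ≫ (biprod.inl ≫ h.r)) with h1 | ⟨n, hn⟩
  · exact Or.inl (key _ _ h1)
  · refine Or.inr (key (h.i ≫ biprod.snd) (biprod.inr ≫ h.r) ?_)
    -- The two endomorphisms sum to the identity, so if the first is nilpotent the second is a unit.
    rw [eq_sub_iff_add_eq'.mpr hsum, ConcreteCategory.isIso_iff_bijective]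
    exact (Module.End.isUnit_iff _).mp (IsNilpotent.isUnit_one_sub ⟨n, hn⟩)

/-- A right approximation by a module of finite length has a minimal version, if the class is closed
under direct summands. -/
lemma exists_minimal_of_isRightApproximation {𝒳 : ObjectProperty (ModuleCat.{u} S)}
    (hfin : ∀ A, 𝒳 A → IsNoetherian S A ∧ IsArtinian S A)
    (hret : ∀ A B : ModuleCat.{u} S, Retract A B → 𝒳 B → 𝒳 A) {A M : ModuleCat.{u} S} (f : A ⟶ M)
    (hf : IsRightApproximation 𝒳 f) :
    ∃ (B : ModuleCat.{u} S) (g : B ⟶ M), IsMinimalRightApproximation 𝒳 g := by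
  induction hl : Module.length S A using WellFoundedLT.induction generalizing A with
  | ind l ih =>
  subst hl
  obtain ⟨_, _⟩ := hfin A hf.1
  by_cases hmin : IsRightMinimal f
  · exact ⟨A, f, hf, hmin⟩
  · simp only [IsRightMinimal, not_forall] at hmin
    obtain ⟨g, hgf, hg⟩ := hmin
    obtain ⟨n, hcompl, hne⟩ := exists_isCompl_of_not_isIso g hg
    have hpow (m : ℕ) : ModuleCat.ofHom (g.hom ^ m) ≫ f = f := by
      induction m with
      | zero => ext x; rfl
      | succ m ih =>
        have : ModuleCat.ofHom (g.hom ^ (m + 1)) = g ≫ ModuleCat.ofHom (g.hom ^ m) := by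
          ext x; simp [pow_succ]
        rw [this, Category.assoc, ih, hgf]
    obtain ⟨r⟩ : Nonempty (Retract (ModuleCat.of S (LinearMap.range (g.hom ^ n))) A) :=
      IsDirectSummand.nonempty_retract ⟨_, ⟨isoBiprodOfIsCompl hcompl.symm⟩⟩
    -- Since `g ^ n` fixes `f`, restricting `f` to the image of `g ^ n` is still an approximation,
    -- of smaller length.
    refine ih _ (Submodule.length_lt hne)
      (ModuleCat.ofHom (LinearMap.range (g.hom ^ n)).subtype ≫ f) ⟨hret _ _ r hf.1, ?_⟩ rfl
    intro X hX k
    obtain ⟨h, hh⟩ := hf.2 X hX k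
    refine ⟨h ≫ ModuleCat.ofHom (g.hom ^ n).rangeRestrict, ?_⟩
    rw [← hh]
    conv_rhs => rw [← hpow n]
    rfl

end FiniteLength

/-! ### Closure properties of 𝒫 and Ext-injectivity -/

section FiniteProjDim

variable {Λ : Type u} [Ring Λ]

lemma fgRightMod_of_epi {M N : RightMod Λ} (f : M ⟶ N) [Epi f] (hM : fgRightMod Λ M) :
    fgRightMod Λ N :=
  haveI : Module.Finite Λᵐᵒᵖ M := hM
  Module.Finite.of_surjective f.hom ((ModuleCat.epi_iff_surjective f).mp inferInstance)

lemma fgRightMod_of_mono [IsNoetherianRing Λᵐᵒᵖ] {M N : RightMod Λ} (f : M ⟶ N) [Mono f]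
    (hN : fgRightMod Λ N) : fgRightMod Λ M :=
  haveI : Module.Finite Λᵐᵒᵖ N := hN
  Module.Finite.of_injective f.hom ((ModuleCat.mono_iff_injective f).mp inferInstance)

lemma fgRightMod_biprod {M N : RightMod Λ} (hM : fgRightMod Λ M) (hN : fgRightMod Λ N) :
    fgRightMod Λ (M ⊞ N) :=
  haveI : Module.Finite Λᵐᵒᵖ M := hM
  haveI : Module.Finite Λᵐᵒᵖ N := hN
  Module.Finite.equiv (ModuleCat.biprodIsoProd M N).toLinearEquiv.symm

lemma finiteProjDim_of_retract {M N : RightMod Λ} (h : Retract M N) (hN : finiteProjDim Λ N) :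
    finiteProjDim Λ M := by
  obtain ⟨hfg, n, hn⟩ := hN
  have : IsSplitEpi h.r := IsSplitEpi.mk' ⟨h.i, h.retract⟩
  exact ⟨fgRightMod_of_epi h.r hfg, n, h.hasProjectiveDimensionLT (n + 1)⟩

lemma finiteProjDim_biprod {M N : RightMod Λ} (hM : finiteProjDim Λ M) (hN : finiteProjDim Λ N) :
    finiteProjDim Λ (M ⊞ N) := by
  obtain ⟨hM, m, hm⟩ := hM
  obtain ⟨hN, n, hn⟩ := hN
  refine ⟨fgRightMod_biprod hM hN, m + n, ?_⟩
  have := hasProjectiveDimensionLT_of_ge M (m + 1) (m + n + 1) (by lia)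
  have := hasProjectiveDimensionLT_of_ge N (n + 1) (m + n + 1) (by lia)
  exact inferInstanceAs (HasProjectiveDimensionLT (M ⊞ N) (m + n + 1))

lemma finiteProjDim_of_projective {P : RightMod Λ} [Projective P] (hP : fgRightMod Λ P) :
    finiteProjDim Λ P :=
  ⟨hP, 0, (projective_iff_hasProjectiveDimensionLE_zero P).mp inferInstance⟩

lemma finiteProjDim_X₃ {T : ShortComplex (RightMod Λ)} (hT : T.ShortExact)
    (h₁ : finiteProjDim Λ T.X₁) (h₂ : finiteProjDim Λ T.X₂) : finiteProjDim Λ T.X₃ := by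
  obtain ⟨_, m, hm⟩ := h₁
  obtain ⟨hfg, n, hn⟩ := h₂
  have := hT.epi_g
  exact ⟨fgRightMod_of_epi T.g hfg, m + n + 1, hT.hasProjectiveDimensionLT_X₃ (m + n + 1)
    (hasProjectiveDimensionLT_of_ge _ (m + 1) _ (by lia))
    (hasProjectiveDimensionLT_of_ge _ (n + 1) _ (by lia))⟩

lemma finiteProjDim_X₁ [IsNoetherianRing Λᵐᵒᵖ] {T : ShortComplex (RightMod Λ)} (hT : T.ShortExact)
    (h₂ : finiteProjDim Λ T.X₂) (h₃ : finiteProjDim Λ T.X₃) : finiteProjDim Λ T.X₁ := by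
  obtain ⟨hfg, m, hm⟩ := h₂
  obtain ⟨_, n, hn⟩ := h₃
  have := hT.mono_f
  exact ⟨fgRightMod_of_mono T.f hfg, m + n, hT.hasProjectiveDimensionLT_X₁ (m + n + 1)
    (hasProjectiveDimensionLT_of_ge _ (m + 1) _ (by lia))
    (hasProjectiveDimensionLT_of_ge _ (n + 1) _ (by lia))⟩

lemma exists_projective_epi {M : RightMod Λ} (hM : fgRightMod Λ M) :
    ∃ (P : RightMod Λ) (p : P ⟶ M), Projective P ∧ fgRightMod Λ P ∧ Epi p := by
  have : Module.Finite Λᵐᵒᵖ M := hM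
  obtain ⟨n, f, hf⟩ := Module.Finite.exists_fin' Λᵐᵒᵖ M
  exact ⟨ModuleCat.of Λᵐᵒᵖ (Fin n → Λᵐᵒᵖ), ModuleCat.ofHom f,
    (IsProjective.iff_projective _).mp inferInstance, inferInstanceAs (Module.Finite _ _),
    (ModuleCat.epi_iff_surjective _).mpr hf⟩

lemma shortExact_kernel {M N : RightMod Λ} (p : M ⟶ N) [Epi p] :
    (ShortComplex.mk (kernel.ι p) p (kernel.condition p)).ShortExact :=
  { exact := ShortComplex.exact_of_f_is_kernel _ (kernelIsKernel p) }

lemma shortExact_cokernel {M N : RightMod Λ} (i : M ⟶ N) [Mono i] :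
    (ShortComplex.mk i (cokernel.π i) (cokernel.condition i)).ShortExact :=
  { exact := ShortComplex.exact_of_g_is_cokernel _ (cokernelIsCokernel i) }

/-- The source of a minimal right approximation of an injective module is Ext-injective. -/
lemma isExtInjective_of_isMinimalRightApproximation [IsNoetherianRing Λᵐᵒᵖ] {A I : RightMod Λ}
    [Injective I] {f : A ⟶ I} (hf : IsMinimalRightApproximation (finiteProjDim Λ) f) :
    IsExtInjective (finiteProjDim Λ) A := by
  refine ⟨hf.1.1, fun Y hY => subsingleton_of_forall_eq 0 fun e => ?_⟩
  obtain ⟨P, p, _, hPfg, _⟩ := exists_projective_epi hY.1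
  have hP := finiteProjDim_of_projective hPfg
  have hses := shortExact_kernel p
  have hK : finiteProjDim Λ (kernel p) := finiteProjDim_X₁ hses hP hY
  obtain ⟨x, rfl⟩ := Ext.contravariant_sequence_exact₃ hses A e
    (Ext.eq_zero_of_projective _) (add_zero 1)
  obtain ⟨g, rfl⟩ := Ext.homEquiv₀.symm.surjective x
  have : Mono (biprod.lift (kernel.ι p) (-g)) :=
    mono_of_mono_fac (biprod.lift_fst (kernel.ι p) (-g))
  -- This cokernel is the pushout of `kernel.ι p` and `g`.
  have hE : finiteProjDim Λ (cokernel (biprod.lift (kernel.ι p) (-g))) :=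
    finiteProjDim_X₃ (shortExact_cokernel _) hK (finiteProjDim_biprod hP hf.1.1)
  let u : P ⟶ I := Injective.factorThru (g ≫ f) (kernel.ι p)
  have hu : kernel.ι p ≫ u = g ≫ f := Injective.comp_factorThru _ _
  obtain ⟨h, hh⟩ := hf.1.2 _ hE (cokernel.desc _ (biprod.desc u f) (by simp [hu]))
  have hφ : IsIso (biprod.inr ≫ cokernel.π (biprod.lift (kernel.ι p) (-g)) ≫ h) :=
    hf.2 _ (by simp [hh])
  have hpush : kernel.ι p ≫ biprod.inl ≫ cokernel.π (biprod.lift (kernel.ι p) (-g)) =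
      g ≫ biprod.inr ≫ cokernel.π (biprod.lift (kernel.ι p) (-g)) := by
    have hlift {Z : RightMod Λ} (c : P ⊞ A ⟶ Z) : biprod.lift (kernel.ι p) (-g) ≫ c =
        kernel.ι p ≫ biprod.inl ≫ c - g ≫ biprod.inr ≫ c := by
      rw [biprod.lift_eq, Preadditive.add_comp, Preadditive.neg_comp, Preadditive.neg_comp,
        Category.assoc, Category.assoc, sub_eq_add_neg]
    exact sub_eq_zero.mp ((hlift _).symm.trans (cokernel.condition _))
  -- Thus `g` extends to `P`, which kills its product with the extension class.
  have hg : g = kernel.ι p ≫ (biprod.inl ≫ cokernel.π (biprod.lift (kernel.ι p) (-g)) ≫ h) ≫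
      inv (biprod.inr ≫ cokernel.π (biprod.lift (kernel.ι p) (-g)) ≫ h) := by
    rw [← Category.assoc, IsIso.eq_comp_inv]
    simpa only [Category.assoc] using congr($(hpush.symm) ≫ h)
  rw [Ext.homEquiv₀_symm_apply, hg, ← Ext.mk₀_comp_mk₀]
  exact hses.extClass_comp_assoc _

lemma IsExtInjective.of_retract {X A : RightMod Λ} (h : Retract X A)
    (hA : IsExtInjective (finiteProjDim Λ) A) : IsExtInjective (finiteProjDim Λ) X := by
  refine ⟨finiteProjDim_of_retract h hA.1, fun Y hY => subsingleton_of_forall_eq 0 fun e => ?_⟩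
  have := hA.2 Y hY
  have h0 : e.comp (Ext.mk₀ h.i) (add_zero 1) = 0 := Subsingleton.elim _ _
  have h1 : (e.comp (Ext.mk₀ h.i) (add_zero 1)).comp (Ext.mk₀ h.r) (add_zero 1) = e := by
    rw [Ext.comp_assoc_of_third_deg_zero, Ext.mk₀_comp_mk₀, h.retract, Ext.comp_mk₀_id]
  rw [← h1, h0, Ext.zero_comp]

/-- A monomorphism from an Ext-injective module to a module of finite projective dimension
splits. -/
lemma IsExtInjective.nonempty_retract {X A : RightMod Λ}
    (hX : IsExtInjective (finiteProjDim Λ) X) (hA : finiteProjDim Λ A) (i : X ⟶ A) [Mono i] :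
    Nonempty (Retract X A) := by
  have hses := shortExact_cokernel i
  have := hX.2 _ (finiteProjDim_X₃ hses hX.1 hA)
  obtain ⟨r, hr⟩ := Ext.contravariant_sequence_exact₁ hses X (Ext.mk₀ (𝟙 X)) (add_zero 1)
    (Subsingleton.elim _ _)
  obtain ⟨r, rfl⟩ := Ext.homEquiv₀.symm.surjective r
  rw [Ext.homEquiv₀_symm_apply, Ext.mk₀_comp_mk₀] at hr
  exact ⟨i, r, Ext.homEquiv₀.symm.injective hr⟩

end FiniteProjDim

/-! ### Embedding in injectives and reduction to indecomposables -/

section ArtinAlgebra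

variable {Λ : Type u} [Ring Λ]

/-- Over an Artin algebra, finitely generated modules embed in finitely generated injectives. -/
lemma exists_mono_injective (R : Type w) [CommRing R] [IsArtinianRing R] [Algebra R Λ]
    [Module.Finite R Λ] {M : RightMod Λ} (hM : fgRightMod Λ M) :
    ∃ (J : RightMod Λ) (i : M ⟶ J), fgRightMod Λ J ∧ Injective J ∧ Mono i := by
  have : Module.Finite Λᵐᵒᵖ M := hM
  let Q := Injective.under M
  have : Module.Injective Λᵐᵒᵖ Q :=
    haveI : Injective (ModuleCat.of Λᵐᵒᵖ Q) := inferInstanceAs (Injective (Injective.under M))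
    Module.injective_module_of_injective_object Λᵐᵒᵖ Q
  let ι : M →ₗ[Λᵐᵒᵖ] Q := (Injective.ι M).hom
  have hι : Function.Injective ι := (ModuleCat.mono_iff_injective _).mp inferInstance
  obtain ⟨E, hE, hess, p, hp⟩ := exists_essential_retract (LinearMap.range ι)
  have hmem (x : M) : ι x ∈ E := hE ⟨x, rfl⟩
  have hfg : (LinearMap.range (ι.codRestrict E hmem)).FG := by
    rw [← Submodule.map_top]
    exact Module.Finite.fg_top.map _
  have hfin : Module.Finite Λᵐᵒᵖ E := by
    refine finite_of_essential R _ hfg fun L hL => ?_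
    refine Submodule.map_injective_of_injective E.subtype_injective ((hess _
      (Submodule.map_subtype_le E L) (Submodule.disjoint_def.mpr ?_)).trans
        (Submodule.map_bot _).symm)
    rintro _ ⟨x, hx, rfl⟩ ⟨y, hy⟩
    have hxy : ι.codRestrict E hmem y = x := Subtype.ext hy
    rw [Submodule.disjoint_def.mp hL x hx ⟨y, hxy⟩, map_zero]
  have hretract : Retract (ModuleCat.of Λᵐᵒᵖ E) Q :=
    ⟨ModuleCat.ofHom E.subtype, ModuleCat.ofHom p, ModuleCat.hom_ext hp⟩
  refine ⟨ModuleCat.of Λᵐᵒᵖ E, ModuleCat.ofHom (ι.codRestrict E hmem), hfin, hretract.injective,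
    (ModuleCat.mono_iff_injective _).mpr fun x y hxy => hι (congrArg Subtype.val hxy)⟩

variable [IsNoetherianRing Λᵐᵒᵖ] [IsArtinianRing Λᵐᵒᵖ]

lemma exists_isMinimalRightApproximation (hP : IsContravariantlyFinite (finiteProjDim Λ))
    {M : RightMod Λ} (hM : fgRightMod Λ M) :
    ∃ (A : RightMod Λ) (f : A ⟶ M), IsMinimalRightApproximation (finiteProjDim Λ) f := by
  obtain ⟨A, f, hf⟩ := hP M hM
  refine exists_minimal_of_isRightApproximation (fun B hB => ?_)
    (fun _ _ => finiteProjDim_of_retract) f hf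
  have : Module.Finite Λᵐᵒᵖ B := hB.1
  exact ⟨inferInstance, inferInstance⟩

lemma length_lt_of_iso_biprod {J J₁ J₂ : RightMod Λ} (hJ : fgRightMod Λ J) (e : J ≅ J₁ ⊞ J₂)
    (h : ¬ IsZero J₂) : Module.length Λᵐᵒᵖ J₁ < Module.length Λᵐᵒᵖ J := by
  have : Module.Finite Λᵐᵒᵖ J := hJ
  have hinj : Function.Injective (biprod.inl ≫ e.inv : J₁ ⟶ J).hom :=
    (ModuleCat.mono_iff_injective _).mp inferInstance
  rw [(LinearEquiv.ofInjective _ hinj).length_eq]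
  refine Submodule.length_lt fun htop => h ?_
  have : Epi (biprod.inl ≫ e.inv : J₁ ⟶ J) :=
    (ModuleCat.epi_iff_surjective _).mpr (LinearMap.range_eq_top.mp htop)
  have hz : (biprod.inl ≫ e.inv : J₁ ⟶ J) ≫ e.hom ≫ biprod.snd = 0 := by simp
  have h0 : e.hom ≫ (biprod.snd : J₁ ⊞ J₂ ⟶ J₂) = 0 := (cancel_epi _).mp (hz.trans comp_zero.symm)
  rw [IsZero.iff_id_eq_zero]
  have := congr((biprod.inr ≫ e.inv) ≫ $h0)
  simpa using this

/-- A finitely generated injective module has a right approximation whose indecomposable summands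
are summands of minimal right approximations of indecomposable injectives. -/
lemma exists_isRightApproximation_of_injective
    (hP : IsContravariantlyFinite (finiteProjDim Λ)) {J : RightMod Λ} (hJ : fgRightMod Λ J)
    (hJinj : Injective J) :
    ∃ (A : RightMod Λ) (f : A ⟶ J), IsRightApproximation (finiteProjDim Λ) f ∧
      ∀ X : RightMod Λ, fgRightMod Λ X → Indecomposable X → Retract X A →
        ∃ (I B : RightMod Λ) (g : B ⟶ I), IsIndecomposableInjective I ∧
          IsMinimalRightApproximation (finiteProjDim Λ) g ∧ Nonempty (Retract X B) := by
  induction hl : Module.length Λᵐᵒᵖ J using WellFoundedLT.induction generalizing J with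
  | ind l ih =>
  subst hl
  by_cases hzero : IsZero J
  · refine ⟨J, 𝟙 J, ⟨?_, fun X _ g => ⟨g, Category.comp_id g⟩⟩, fun X _ hX r => ?_⟩
    · have : Projective J := hzero.projective
      exact finiteProjDim_of_projective hJ
    · refine absurd ((IsZero.iff_id_eq_zero X).mpr ?_) hX.1
      -- The approximation of zero is zero, which has no indecomposable retract.
      rw [← r.retract, hzero.eq_of_tgt r.i 0, zero_comp]
  by_cases hind : Indecomposable J
  · obtain ⟨A, f, hf⟩ := exists_isMinimalRightApproximation hP hJ
    exact ⟨A, f, hf.1, fun X _ _ r => ⟨J, A, f, ⟨hJ, hJinj, hind⟩, hf, ⟨r⟩⟩⟩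
  simp only [Indecomposable, not_and, not_forall, not_or] at hind
  obtain ⟨J₁, J₂, e, h₁, h₂⟩ := hind hzero
  have r₁ : Retract J₁ J := ⟨biprod.inl ≫ e.inv, e.hom ≫ biprod.fst, by simp⟩
  have r₂ : Retract J₂ J := ⟨biprod.inr ≫ e.inv, e.hom ≫ biprod.snd, by simp⟩
  have : Epi r₁.r := (IsSplitEpi.mk' ⟨r₁.i, r₁.retract⟩ : IsSplitEpi r₁.r).epi
  have : Epi r₂.r := (IsSplitEpi.mk' ⟨r₂.i, r₂.retract⟩ : IsSplitEpi r₂.r).epi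
  obtain ⟨A₁, f₁, hf₁, hs₁⟩ := ih _ (length_lt_of_iso_biprod hJ e h₂)
    (fgRightMod_of_epi r₁.r hJ) r₁.injective rfl
  obtain ⟨A₂, f₂, hf₂, hs₂⟩ := ih _
    (length_lt_of_iso_biprod hJ (e ≪≫ biprod.braiding J₁ J₂) h₁)
    (fgRightMod_of_epi r₂.r hJ) r₂.injective rfl
  refine ⟨A₁ ⊞ A₂, biprod.map f₁ f₂ ≫ e.symm.hom,
    (hf₁.biprod_map hf₂ (finiteProjDim_biprod hf₁.1 hf₂.1)).comp_iso e.symm,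
    fun X hXfg hX r => ?_⟩
  have : Module.Finite Λᵐᵒᵖ X := hXfg
  rcases Indecomposable.retract_of_retract_biprod hX r with ⟨⟨r⟩⟩ | ⟨⟨r⟩⟩
  · exact hs₁ X hXfg hX r
  · exact hs₂ X hXfg hX r

lemma IsExtInjective.exists_isDirectSummand (R : Type w) [CommRing R] [IsArtinianRing R]
    [Algebra R Λ] [Module.Finite R Λ] (hP : IsContravariantlyFinite (finiteProjDim Λ))
    {X : RightMod Λ} (hX : Indecomposable X) (hext : IsExtInjective (finiteProjDim Λ) X) :
    ∃ (I A : RightMod Λ) (f : A ⟶ I), IsIndecomposableInjective I ∧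
      IsMinimalRightApproximation (finiteProjDim Λ) f ∧ IsDirectSummand X A := by
  obtain ⟨J, i, hJ, hJinj, _⟩ := exists_mono_injective R hext.1.1
  obtain ⟨A, f, hf, hs⟩ := exists_isRightApproximation_of_injective hP hJ hJinj
  obtain ⟨k, rfl⟩ := hf.2 X hext.1 i
  have : Mono k := mono_of_mono k f
  obtain ⟨r⟩ := hext.nonempty_retract hf.1 k
  obtain ⟨I, B, g, hI, hg, ⟨r'⟩⟩ := hs X hext.1.1 hX r
  exact ⟨I, B, g, hI, hg, Retract.isDirectSummand r'⟩

end ArtinAlgebra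

end ApproximationTheory

theorem mainTheorem3 {R : Type w} {Λ : Type u} [CommRing R] [IsArtinianRing R]
    [Ring Λ] [Algebra R Λ] [Module.Finite R Λ]
    (hP : ApproximationTheory.IsContravariantlyFinite
      (ApproximationTheory.finiteProjDim Λ)) :
    -- each indecomposable injective has a minimal right approximation
    (∀ I : ApproximationTheory.RightMod Λ, ApproximationTheory.IsIndecomposableInjective I →
      ∃ (A : ApproximationTheory.RightMod Λ) (f : A ⟶ I),
        ApproximationTheory.IsMinimalRightApproximation
          (ApproximationTheory.finiteProjDim Λ) f) ∧
    -- which is unique up to isomorphism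
    (∀ I : ApproximationTheory.RightMod Λ, ApproximationTheory.IsIndecomposableInjective I →
      ∀ (A A' : ApproximationTheory.RightMod Λ) (f : A ⟶ I) (f' : A' ⟶ I),
        ApproximationTheory.IsMinimalRightApproximation
          (ApproximationTheory.finiteProjDim Λ) f →
        ApproximationTheory.IsMinimalRightApproximation
          (ApproximationTheory.finiteProjDim Λ) f' →
        ∃ e : A ≅ A', e.hom ≫ f' = f) ∧
    -- and their indecomposable direct summands are the indecomposable Ext-injectives
    (∀ X : ApproximationTheory.RightMod Λ, Indecomposable X →
      ((∃ (I A : ApproximationTheory.RightMod Λ) (f : A ⟶ I),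
          ApproximationTheory.IsIndecomposableInjective I ∧
          ApproximationTheory.IsMinimalRightApproximation
            (ApproximationTheory.finiteProjDim Λ) f ∧
          ApproximationTheory.IsDirectSummand X A) ↔
        ApproximationTheory.IsExtInjective (ApproximationTheory.finiteProjDim Λ) X)) := by
  have : IsNoetherianRing Λᵐᵒᵖ := IsNoetherianRing.of_finite R Λᵐᵒᵖ
  have : IsArtinianRing Λᵐᵒᵖ := IsArtinianRing.of_finite R Λᵐᵒᵖ
  refine ⟨fun I hI => ApproximationTheory.exists_isMinimalRightApproximation hP hI.1,
    fun I _ A A' f f' hf hf' => hf.exists_iso hf', fun X hX => ⟨?_, fun hext =>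
      ApproximationTheory.IsExtInjective.exists_isDirectSummand R hP hX hext⟩⟩
  rintro ⟨I, A, f, ⟨_, hI, _⟩, hf, hXA⟩
  obtain ⟨r⟩ := hXA.nonempty_retract
  exact (ApproximationTheory.isExtInjective_of_isMinimalRightApproximation hf).of_retract r
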